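/- Let $k$ be a field of characteristic zero. For $n\ge 0$ let $P_n=k[x_1,\dots,x_n]$, and let $\prec$ be the degree reverse lexicographic order with $x_n\prec\cdots\prec x_1$. For a non-zero homogeneous ideal $I\subseteq P_n$: * $\operatorname{LT}(I)$ is the ideal generated by the leading terms of the non-zero elements of $I$, and $\deg(I,\prec)$ is the maximal (total) degree of an element of the reduced Gröbner basis of $I$ with respect to $\prec$. * A monomial ideal $J\subseteq P_n$ is quasi stable if for every term $m\in J$ and all integers $i,j,s$ with $1\le j<i\le n$, $s>0$ and $x_i^s\mid m$ there is $t\ge 0$ with $x_j^t m/x_i^s\in J$. The ideal $I$ is in quasi stable position if $\operatorname{LT}(I)$ is quasi stable. * $\dim(I)$ is the Krull dimension of $P_n/I$, and $\operatorname{depth}(I)$ is the maximal length of a regular sequence of linear forms on $P_n/I$. Suppose that $U(n,d,D)$ is a real-valued function of $n,d,D\in\mathbb{N}$ such that, for all $n$, $d$ and $D$, $\deg(I,\prec)\le U(n,d,D)$ holds for every non-zero ideal $I\subseteq P_n$ with $\dim(I)=D$ which is in quasi stable position and is generated by finitely many non-zero homogeneous polynomials of positive degree at most $d$. Then, for every non-zero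 ideal $I\subseteq P_n$ which is in quasi stable position, is generated by finitely many non-zero homogeneous polynomials of positive degree at most $d$, and has $\dim(I)=D$ and $\operatorname{depth}(I)=\lambda$, one has $\lambda\le D\le n$ and $$\deg(I,\prec)\le U(n-\lambda,d,D-\lambda).$$ -/

import Mathlib

open MvPolynomial

noncomputable section

/-- The set of exponent vectors of the terms in `x_0, …, x_{n-1}`, as a type synonym which carries
the degree reverse lexicographic order with `x_{n-1} ≺ ⋯ ≺ x_1 ≺ x_0`; see `DegRevLex.lt_iff`. -/
def DegRevLex (n : ℕ) : Type := Fin n →₀ ℕ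

namespace DegRevLex

variable {n : ℕ}

instance : AddCommMonoid (DegRevLex n) := inferInstanceAs (AddCommMonoid (Fin n →₀ ℕ))

/-- The underlying exponent vector. -/
def exps (a : DegRevLex n) : Fin n →₀ ℕ := a

/-- An exponent vector, regarded as an element of the type synonym. -/
def ofExps : (Fin n →₀ ℕ) ≃+ DegRevLex n := AddEquiv.refl _

/-- The total degree, followed by the exponents read from the last one to the first one and with
reversed order; the degree reverse lexicographic order compares these keys lexicographically. -/
def key (a : DegRevLex n) : ℕ ×ₗ Lex ((Fin n)ᵒᵈ → ℕᵒᵈ) :=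
  toLex (a.exps.degree, toLex (fun i => OrderDual.toDual (a.exps (OrderDual.ofDual i))))

lemma key_injective : Function.Injective (key (n := n)) := by
  intro a b h
  have h2 : (fun i : (Fin n)ᵒᵈ => OrderDual.toDual (a.exps (OrderDual.ofDual i)))
      = fun i => OrderDual.toDual (b.exps (OrderDual.ofDual i)) := (Prod.ext_iff.1 h).2
  exact Finsupp.ext fun i => congrFun h2 (OrderDual.toDual i)

instance : LinearOrder (DegRevLex n) := LinearOrder.lift' key key_injective

/-- `a ≺ b` iff `|a| < |b|`, or `|a| = |b|` and, at the last index where `a` and `b` differ,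
the exponent of `a` is the larger one. -/
lemma lt_iff {a b : DegRevLex n} : a < b ↔ a.exps.degree < b.exps.degree ∨
    a.exps.degree = b.exps.degree ∧
      ∃ i : Fin n, (∀ j, i < j → a.exps j = b.exps j) ∧ b.exps i < a.exps i := by
  change key a < key b ↔ _
  rw [key, key, Prod.Lex.toLex_lt_toLex]
  rfl

lemma exps_add (a b : DegRevLex n) : (a + b).exps = a.exps + b.exps := rfl

instance : IsOrderedAddMonoid (DegRevLex n) where
  add_le_add_left a b h c := by
    rcases h.eq_or_lt with rfl | h
    · exact le_rfl
    · refine le_of_lt ?_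
      rw [lt_iff] at h ⊢
      simpa [exps_add] using h

lemma le_of_exps_le {a b : DegRevLex n} (h : a.exps ≤ b.exps) : a ≤ b := by
  by_cases hab : a = b
  · exact hab.le
  refine le_of_lt (lt_iff.2 (Or.inl ?_))
  obtain ⟨c, hc⟩ := exists_add_of_le h
  have hc0 : c ≠ 0 := by
    rintro rfl
    exact hab (hc.trans (add_zero _)).symm
  have : c.degree ≠ 0 := fun h0 => hc0 ((Finsupp.degree_eq_zero_iff _).1 h0)
  have hd : b.exps.degree = a.exps.degree + c.degree := by rw [hc, map_add]
  omega

instance : WellFoundedLT (DegRevLex n) := by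
  have : WellQuasiOrderedLE (DegRevLex n) :=
    ⟨fun f => (wellQuasiOrdered_le (α := Fin n →₀ ℕ) f).imp fun _ h => h.imp fun _ h =>
      ⟨h.1, le_of_exps_le h.2⟩⟩
  infer_instance

end DegRevLex

/-- The degree reverse lexicographic order on the terms in `x_0, …, x_{n-1}` with
`x_{n-1} ≺ ⋯ ≺ x_0`, as a monomial order. -/
def degRevLex (n : ℕ) : MonomialOrder (Fin n) where
  syn := DegRevLex n
  toSyn := DegRevLex.ofExps
  toSyn_monotone _ _ h := DegRevLex.le_of_exps_le h

lemma degRevLex_lt_iff {n : ℕ} {a b : Fin n →₀ ℕ} :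
    (degRevLex n).toSyn a < (degRevLex n).toSyn b ↔ a.degree < b.degree ∨
      a.degree = b.degree ∧ ∃ i : Fin n, (∀ j, i < j → a j = b j) ∧ b i < a i :=
  DegRevLex.lt_iff

section Ideals

variable {k : Type*} [Field k] {n : ℕ}

/-- The leading ideal `LT(I)`, generated by the leading terms (power products, without
coefficients) of the non-zero elements of `I`. -/
def leadingIdeal (m : MonomialOrder (Fin n)) (I : Ideal (MvPolynomial (Fin n) k)) :
    Ideal (MvPolynomial (Fin n) k) :=
  Ideal.span {p | ∃ f ∈ I, f ≠ 0 ∧ p = monomial (m.degree f) 1}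

/-- `G` is the reduced Gröbner basis of `I`: a finite subset of `I` whose leading terms generate
`LT(I)`, consisting of monic polynomials, such that no term occurring in an element of `G` is
divisible by the leading term of another element of `G`. -/
structure IsReducedGroebnerBasis (m : MonomialOrder (Fin n))
    (I : Ideal (MvPolynomial (Fin n) k)) (G : Finset (MvPolynomial (Fin n) k)) : Prop where
  subset : ∀ g ∈ G, g ∈ I
  span_eq : leadingIdeal m I =
    Ideal.span ((fun g => monomial (m.degree g) (1 : k)) '' (G : Set (MvPolynomial (Fin n) k)))
  monic : ∀ g ∈ G, m.Monic g
  reduced : ∀ g ∈ G, ∀ g' ∈ G, g' ≠ g → ∀ a ∈ g.support, ¬ m.degree g' ≤ a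

/-- `deg(I, ≺) = e`: the maximal degree of an element of the reduced Gröbner basis of `I`
is `e`. -/
def IsGroebnerDegree (m : MonomialOrder (Fin n)) (I : Ideal (MvPolynomial (Fin n) k))
    (e : ℕ) : Prop :=
  ∃ G : Finset (MvPolynomial (Fin n) k), IsReducedGroebnerBasis m I G ∧
    IsGreatest {s | ∃ g ∈ G, s = g.totalDegree} e

/-- Quasi stability (of a monomial ideal `J`): for every term `m ∈ J`, all `j < i` and all `s > 0`
with `x_i ^ s ∣ m` there is `t ≥ 0` with `x_j ^ t * m / x_i ^ s ∈ J`. -/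
def IsQuasiStable (J : Ideal (MvPolynomial (Fin n) k)) : Prop :=
  ∀ a : Fin n →₀ ℕ, monomial a (1 : k) ∈ J → ∀ i j : Fin n, j < i → ∀ s : ℕ, 0 < s → s ≤ a i →
    ∃ t : ℕ, monomial (a - Finsupp.single i s + Finsupp.single j t) (1 : k) ∈ J

/-- `I` is in quasi stable position: its leading ideal for the degree reverse lexicographic order
is quasi stable. -/
def InQuasiStablePosition (I : Ideal (MvPolynomial (Fin n) k)) : Prop :=
  IsQuasiStable (leadingIdeal (degRevLex n) I)

/-- `I` is generated by finitely many non-zero homogeneous polynomials of positive degree at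
most `d`. -/
def IsGeneratedInDegreeLE (I : Ideal (MvPolynomial (Fin n) k)) (d : ℕ) : Prop :=
  ∃ F : Finset (MvPolynomial (Fin n) k),
    (∀ f ∈ F, f ≠ 0 ∧ ∃ e : ℕ, 0 < e ∧ e ≤ d ∧ f.IsHomogeneous e) ∧
    I = Ideal.span (F : Set (MvPolynomial (Fin n) k))

/-- `depth(I) = l`: the maximal length of a regular sequence of linear forms on the factor ring
by `I` is `l`. -/
def IsDepth (I : Ideal (MvPolynomial (Fin n) k)) (l : ℕ) : Prop :=
  IsGreatest {r : ℕ | ∃ ys : List (MvPolynomial (Fin n) k), ys.length = r ∧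
    (∀ y ∈ ys, y.IsHomogeneous 1) ∧
    RingTheory.Sequence.IsRegular (MvPolynomial (Fin n) k ⧸ I) ys} l

end Ideals

end

/-!
Suppose that `y` is a nonzerodivisor modulo `I` without constant term. Quasi stability leaves only
finitely many terms `b ∉ LT(I)` with `x_n b ∈ LT(I)`, so that `x_n f ∈ I` implies `f ∈ I` for `f` of
high degree; multiplying by a power of `y` removes the restriction on the degree. Hence `x_n` is a
nonzerodivisor modulo `I`.

For the degree reverse lexicographic order a homogeneous polynomial is divisible by `x_n` as soon
as its leading term is. Therefore `x_n` does not occur in the minimal generators of `LT(I)`, and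
setting `x_n = 0` turns the reduced Gröbner basis of `I` into the one of the specialized ideal,
with the same degrees. The specialized ideal is again in quasi stable position and generated in
degree at most `d`. Its dimension is one less, because for an ideal in quasi stable position the
dimension is the number of variables of which no power is a leading term. By Rees' theorem it
admits a regular sequence shorter by one, and the argument can be iterated.
-/

section LeadingExponents

variable {σ R : Type*} [CommSemiring R] {m : MonomialOrder σ}

/-- The exponent vectors of the leading terms of the non-zero elements of `I`: over a field, those
of the terms in the leading ideal of `I`. -/
def leadExps (m : MonomialOrder σ) (I : Ideal (MvPolynomial σ R)) : Set (σ →₀ ℕ) :=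
  {a | ∃ f ∈ I, f ≠ 0 ∧ m.degree f = a}

lemma degree_eq_of_mem_support {f : MvPolynomial σ R} {a : σ →₀ ℕ} (ha : a ∈ f.support)
    (h : ∀ c ∈ f.support, m.toSyn c ≤ m.toSyn a) : m.degree f = a :=
  m.toSyn.injective (le_antisymm (m.degree_le_iff.2 h) (m.le_degree ha))

lemma degree_add_degree_mem_leadExps {I : Ideal (MvPolynomial σ R)} {f g : MvPolynomial σ R}
    (hf : m.Monic f) (hg : g ≠ 0) (hfg : f * g ∈ I) :
    m.degree f + m.degree g ∈ leadExps m I := by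
  have hreg : IsRegular (m.leadingCoeff f) := hf ▸ isRegular_one
  refine ⟨f * g, hfg, fun h => hg ?_, m.degree_mul_of_isRegular_left hreg hg⟩
  rwa [← m.leadingCoeff_eq_zero_iff, m.leadingCoeff_mul_of_isRegular_left hreg, hf, one_mul,
    m.leadingCoeff_eq_zero_iff] at h

lemma isUpperSet_leadExps (I : Ideal (MvPolynomial σ R)) : IsUpperSet (leadExps m I) := by
  rintro _ b hb ⟨f, hf, hf0, rfl⟩
  have hmem := degree_add_degree_mem_leadExps (m.monic_monomial_one (d := b - m.degree f)) hf0
    (I.mul_mem_left _ hf)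
  have : Nontrivial R := ⟨_, _, m.leadingCoeff_ne_zero_iff.2 hf0⟩
  classical
  rwa [m.degree_monomial, if_neg one_ne_zero, tsub_add_cancel_of_le hb] at hmem

lemma leadExps_nonempty_iff {I : Ideal (MvPolynomial σ R)} : (leadExps m I).Nonempty ↔ I ≠ ⊥ := by
  rw [Submodule.ne_bot_iff]
  exact ⟨fun ⟨_, f, hf, hf0, _⟩ => ⟨f, hf, hf0⟩, fun ⟨f, hf, hf0⟩ => ⟨_, f, hf, hf0, rfl⟩⟩

end LeadingExponents

section LeadingIdeal

variable {σ k : Type*} [Field k] {n : ℕ}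

lemma zero_notMem_leadExps {m : MonomialOrder σ} {I : Ideal (MvPolynomial σ k)} (hI : I ≠ ⊤) :
    0 ∉ leadExps m I := by
  rintro ⟨f, hf, hf0, h⟩
  rw [m.eq_C_of_degree_eq_zero h] at hf
  exact hI (I.eq_top_of_isUnit_mem hf
    ((isUnit_iff_ne_zero.2 (m.leadingCoeff_ne_zero_iff.2 hf0)).map C))

lemma exists_mem_add_eq_of_notMem_leadExps (m : MonomialOrder σ) (I : Ideal (MvPolynomial σ k))
    (f : MvPolynomial σ k) : ∃ g ∈ I, ∃ r, f = g + r ∧ ∀ c ∈ r.support, c ∉ leadExps m I := by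
  obtain ⟨q, r, hf, -, hr⟩ := m.div_set (B := {g | g ∈ I ∧ g ≠ 0})
    (fun g hg => isUnit_iff_ne_zero.2 (m.leadingCoeff_ne_zero_iff.2 hg.2)) f
  refine ⟨_, ?_, r, hf, fun c hc ⟨g, hg, hg0, hgc⟩ => hr c hc g ⟨hg, hg0⟩ hgc.le⟩
  exact I.sum_mem fun g _ => I.mul_mem_left _ g.2.1

lemma leadingIdeal_eq_span (m : MonomialOrder (Fin n)) (I : Ideal (MvPolynomial (Fin n) k)) :
    leadingIdeal m I = Ideal.span ((fun s => monomial s (1 : k)) '' leadExps m I) := by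
  unfold leadingIdeal
  congr 1
  ext p
  simp only [leadExps, Set.mem_image, Set.mem_ofPred_eq]
  grind

lemma monomial_mem_leadingIdeal_iff {m : MonomialOrder (Fin n)}
    {I : Ideal (MvPolynomial (Fin n) k)} {a : Fin n →₀ ℕ} :
    monomial a (1 : k) ∈ leadingIdeal m I ↔ a ∈ leadExps m I := by
  classical
  rw [leadingIdeal_eq_span, mem_ideal_span_monomial_image]
  simp only [support_monomial, one_ne_zero, if_false, Finset.mem_singleton, forall_eq]
  exact ⟨fun ⟨_, hs, h⟩ => isUpperSet_leadExps I h hs, fun h => ⟨a, h, le_rfl⟩⟩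

lemma inQuasiStablePosition_iff {I : Ideal (MvPolynomial (Fin n) k)} :
    InQuasiStablePosition I ↔ ∀ a ∈ leadExps (degRevLex n) I, ∀ i j : Fin n, j < i →
      ∀ s : ℕ, 0 < s → s ≤ a i →
        ∃ t : ℕ, a - Finsupp.single i s + Finsupp.single j t ∈ leadExps (degRevLex n) I := by
  simp only [InQuasiStablePosition, IsQuasiStable, monomial_mem_leadingIdeal_iff]

lemma leadingIdeal_eq_span_degree_iff {m : MonomialOrder (Fin n)}
    {I : Ideal (MvPolynomial (Fin n) k)} {G : Finset (MvPolynomial (Fin n) k)}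
    (hG : ∀ g ∈ G, g ∈ I ∧ g ≠ 0) :
    leadingIdeal m I = Ideal.span ((fun g => monomial (m.degree g) (1 : k)) ''
      (G : Set (MvPolynomial (Fin n) k))) ↔
      ∀ a ∈ leadExps m I, ∃ g ∈ G, m.degree g ≤ a := by
  classical
  rw [← Set.image_image (fun s => monomial s (1 : k)) m.degree]
  refine ⟨fun h a ha => ?_, fun h => le_antisymm ?_ (Ideal.span_le.2 ?_)⟩
  · rw [← monomial_mem_leadingIdeal_iff, h, mem_ideal_span_monomial_image] at ha
    obtain ⟨_, ⟨g, hg, rfl⟩, hga⟩ := ha a (by simp)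
    exact ⟨g, hg, hga⟩
  · rw [leadingIdeal_eq_span, Ideal.span_le]
    rintro _ ⟨a, ha, rfl⟩
    obtain ⟨g, hg, hga⟩ := h a ha
    simp only [SetLike.mem_coe, mem_ideal_span_monomial_image, Set.exists_mem_image]
    intro c hc
    obtain rfl := Finset.mem_singleton.1 (support_monomial_subset hc)
    exact ⟨g, hg, hga⟩
  · rintro _ ⟨_, ⟨g, hg, rfl⟩, rfl⟩
    exact monomial_mem_leadingIdeal_iff.2 ⟨g, (hG g hg).1, (hG g hg).2, rfl⟩

lemma IsReducedGroebnerBasis.ne_zero {m : MonomialOrder (Fin n)}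
    {I : Ideal (MvPolynomial (Fin n) k)} {G : Finset (MvPolynomial (Fin n) k)}
    (hG : IsReducedGroebnerBasis m I G) {g : MvPolynomial (Fin n) k} (hg : g ∈ G) : g ≠ 0 :=
  (hG.monic g hg).ne_zero

lemma IsReducedGroebnerBasis.exists_degree_le {m : MonomialOrder (Fin n)}
    {I : Ideal (MvPolynomial (Fin n) k)} {G : Finset (MvPolynomial (Fin n) k)}
    (hG : IsReducedGroebnerBasis m I G) {a : Fin n →₀ ℕ} (ha : a ∈ leadExps m I) :
    ∃ g ∈ G, m.degree g ≤ a :=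
  (leadingIdeal_eq_span_degree_iff fun g hg => ⟨hG.subset g hg, hG.ne_zero hg⟩).1 hG.span_eq a ha

end LeadingIdeal

section Homogeneous

variable {σ R : Type*} [CommSemiring R] {n : ℕ}

lemma degree_le_of_degRevLex_le {a b : Fin n →₀ ℕ}
    (h : (degRevLex n).toSyn a ≤ (degRevLex n).toSyn b) : a.degree ≤ b.degree := by
  by_contra! hlt
  exact h.not_gt (degRevLex_lt_iff.2 (Or.inl hlt))

lemma totalDegree_eq_degree_degRevLex (f : MvPolynomial (Fin n) R) :
    f.totalDegree = ((degRevLex n).degree f).degree := by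
  by_cases hf : f = 0
  · simp [hf]
  apply le_antisymm
  · exact Finset.sup_le fun c hc => degree_le_of_degRevLex_le ((degRevLex n).le_degree hc)
  · exact le_totalDegree ((degRevLex n).degree_mem_support hf)

lemma degree_eq_of_isHomogeneous {f : MvPolynomial σ R} {d : ℕ} (hf : f.IsHomogeneous d)
    {a : σ →₀ ℕ} (ha : a ∈ f.support) : a.degree = d := by
  rw [hf.degree_eq_sum_deg_support ha, Finsupp.degree_apply]

lemma support_homogeneousComponent_subset (d : ℕ) (f : MvPolynomial σ R) :
    (homogeneousComponent d f).support ⊆ f.support := fun c hc => by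
  rw [mem_support_iff, coeff_homogeneousComponent] at hc
  exact mem_support_iff.2 (ite_ne_right_iff.1 hc).2

lemma homogeneousComponent_X_mul (d : ℕ) (i : σ) (f : MvPolynomial σ R) :
    homogeneousComponent (d + 1) (X i * f) = X i * homogeneousComponent d f := by
  classical
  ext a
  simp only [coeff_homogeneousComponent, coeff_X_mul']
  by_cases hi : i ∈ a.support
  · have hle : Finsupp.single i 1 ≤ a := by simpa [Nat.one_le_iff_ne_zero] using hi
    have hdeg : a.degree = (a - Finsupp.single i 1).degree + 1 := by
      conv_lhs => rw [← tsub_add_cancel_of_le hle]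
      rw [map_add, Finsupp.degree_single]
    simp [hi, hdeg]
  · simp [hi]

lemma mem_idealOfVars_iff {f : MvPolynomial σ R} :
    f ∈ idealOfVars σ R ↔ constantCoeff f = 0 := by
  rw [← pow_one (idealOfVars σ R), mem_pow_idealOfVars_iff', constantCoeff_eq]
  simp [Finsupp.degree_eq_zero_iff]

lemma mem_idealOfVars_of_isHomogeneous {f : MvPolynomial σ R} {d : ℕ} (hf : f.IsHomogeneous d)
    (hd : 0 < d) : f ∈ idealOfVars σ R :=
  mem_idealOfVars_iff.2 (hf.coeff_eq_zero (by simpa using hd.ne))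

lemma idealOfVars_ne_top [Nontrivial R] : idealOfVars σ R ≠ ⊤ := by
  rw [Ideal.ne_top_iff_one, mem_idealOfVars_iff, map_one]
  exact one_ne_zero

attribute [local instance] MvPolynomial.gradedAlgebra

lemma exists_isHomogeneous_of_mem_leadExps {m : MonomialOrder σ} {I : Ideal (MvPolynomial σ R)}
    (hI : I.IsHomogeneous (homogeneousSubmodule σ R)) {a : σ →₀ ℕ} (ha : a ∈ leadExps m I) :
    ∃ f ∈ I, f ≠ 0 ∧ m.degree f = a ∧ f.IsHomogeneous a.degree := by
  obtain ⟨f, hf, hf0, rfl⟩ := ha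
  set a := m.degree f
  have hmem : a ∈ (homogeneousComponent a.degree f).support := by
    rw [mem_support_iff, coeff_homogeneousComponent, if_pos rfl]
    exact m.coeff_degree_ne_zero_iff.2 hf0
  refine ⟨_, homogeneousComponent_mem_of_mem hI hf a.degree, ne_zero_iff.2 ⟨a, ?_⟩, ?_,
    homogeneousComponent_isHomogeneous _ _⟩
  · exact mem_support_iff.1 hmem
  · exact degree_eq_of_mem_support hmem fun c hc =>
      m.le_degree (support_homogeneousComponent_subset _ f hc)

lemma exists_isHomogeneous_mem_add_eq_of_notMem_leadExps {k : Type*} [Field k]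
    (m : MonomialOrder σ) {I : Ideal (MvPolynomial σ k)}
    (hI : I.IsHomogeneous (homogeneousSubmodule σ k)) {f : MvPolynomial σ k} {d : ℕ}
    (hf : f.IsHomogeneous d) :
    ∃ g ∈ I, ∃ r, f = g + r ∧ r.IsHomogeneous d ∧ ∀ c ∈ r.support, c ∉ leadExps m I := by
  obtain ⟨g, hg, r, hgr, hr⟩ := exists_mem_add_eq_of_notMem_leadExps m I f
  refine ⟨_, homogeneousComponent_mem_of_mem hI hg d, homogeneousComponent d r, ?_,
    homogeneousComponent_isHomogeneous d r,
    fun c hc => hr c (support_homogeneousComponent_subset d r hc)⟩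
  rw [← map_add, ← hgr, homogeneousComponent_eq_self hf]

lemma IsGeneratedInDegreeLE.isHomogeneous {k : Type*} [Field k]
    {I : Ideal (MvPolynomial (Fin n) k)} {d : ℕ} (h : IsGeneratedInDegreeLE I d) :
    I.IsHomogeneous (homogeneousSubmodule (Fin n) k) := by
  obtain ⟨F, hF, rfl⟩ := h
  refine Ideal.homogeneous_span _ _ fun f hf => ?_
  obtain ⟨-, e, -, -, he⟩ := hF f hf
  exact ⟨e, he⟩

lemma IsGeneratedInDegreeLE.le_idealOfVars {k : Type*} [Field k]
    {I : Ideal (MvPolynomial (Fin n) k)} {d : ℕ} (h : IsGeneratedInDegreeLE I d) :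
    I ≤ idealOfVars (Fin n) k := by
  obtain ⟨F, hF, rfl⟩ := h
  refine Ideal.span_le.2 fun f hf => ?_
  obtain ⟨-, e, he0, -, he⟩ := hF f hf
  exact mem_idealOfVars_of_isHomogeneous he he0

end Homogeneous

section LastVariable

attribute [local instance] MvPolynomial.gradedAlgebra

/-- Every element of `S` lies above one of the finitely many minimal ones; the hypothesis bounds
the distance of the elements of `S \ E` from it in every direction. -/
lemma finite_sdiff_of_forall_exists_add_single_mem {σ : Type*} [Finite σ] {E S : Set (σ →₀ ℕ)}
    (hE : IsUpperSet E) (h : ∀ b ∈ S, ∀ j, ∃ t, b + Finsupp.single j t ∈ E) : (S \ E).Finite := by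
  have hmin : {b | Minimal (· ∈ S) b}.Finite :=
    (setOfPred_minimal_antichain _).finite_of_wellQuasiOrdered wellQuasiOrdered_le
  choose! t ht using h
  classical
  cases nonempty_fintype σ
  refine (hmin.biUnion fun c _ =>
    Set.finite_Iic (c + Finsupp.equivFunOnFinite.symm (t c))).subset fun b ⟨hbS, hbE⟩ => ?_
  obtain ⟨c, hcb, hc⟩ := exists_minimal_le_of_wellFoundedLT (· ∈ S) b hbS
  refine Set.mem_biUnion hc fun j => ?_
  by_contra! hlt
  refine hbE (hE (fun l => ?_) (ht c hc.prop j))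
  rcases eq_or_ne l j with rfl | hl
  · simpa using hlt.le
  · simpa [Finsupp.single_eq_of_ne hl] using hcb l

variable {k : Type*} [Field k] {n : ℕ}

lemma InQuasiStablePosition.finite_add_single_last_mem {I : Ideal (MvPolynomial (Fin (n + 1)) k)}
    (hqs : InQuasiStablePosition I) :
    ({b | b + Finsupp.single (Fin.last n) 1 ∈ leadExps (degRevLex (n + 1)) I} \
      leadExps (degRevLex (n + 1)) I).Finite := by
  refine finite_sdiff_of_forall_exists_add_single_mem (isUpperSet_leadExps I) fun b hb j => ?_
  rcases (Fin.le_last j).eq_or_lt with rfl | hj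
  · exact ⟨1, hb⟩
  · obtain ⟨t, ht⟩ := inQuasiStablePosition_iff.1 hqs _ hb (Fin.last n) j hj 1 one_pos (by simp)
    exact ⟨t, by simpa using ht⟩

lemma InQuasiStablePosition.exists_forall_mem_of_X_last_mul_mem
    {I : Ideal (MvPolynomial (Fin (n + 1)) k)} (hqs : InQuasiStablePosition I)
    (hI : I.IsHomogeneous (homogeneousSubmodule _ k)) :
    ∃ N, ∀ d > N, ∀ f : MvPolynomial (Fin (n + 1)) k, f.IsHomogeneous d →
      X (Fin.last n) * f ∈ I → f ∈ I := by
  obtain ⟨N, hN⟩ := (hqs.finite_add_single_last_mem.image Finsupp.degree).bddAbove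
  refine ⟨N, fun d hd f hfd hf => ?_⟩
  set m := degRevLex (n + 1)
  obtain ⟨g, hg, r, rfl, hrd, hr⟩ := exists_isHomogeneous_mem_add_eq_of_notMem_leadExps m hI hfd
  suffices r = 0 by rwa [this, add_zero]
  by_contra hr0
  have hrsupp := m.degree_mem_support hr0
  have hXr : X (Fin.last n) * r ∈ I := by
    rwa [mul_add, I.add_mem_iff_right (I.mul_mem_left _ hg)] at hf
  have hmem := degree_add_degree_mem_leadExps m.monic_X hr0 hXr
  rw [m.degree_X, add_comm (Finsupp.single (Fin.last n) 1)] at hmem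
  have hle : (m.degree r).degree ≤ N := hN ⟨_, ⟨hmem, hr _ hrsupp⟩, rfl⟩
  rw [degree_eq_of_isHomogeneous hrd hrsupp] at hle
  exact hle.not_gt hd

/-- Multiplication by a high power of `y` moves every polynomial into high degrees, where
`X (Fin.last n)` is regular by quasi stability. -/
lemma InQuasiStablePosition.isSMulRegular_X_last {I : Ideal (MvPolynomial (Fin (n + 1)) k)}
    (hqs : InQuasiStablePosition I) (hI : I.IsHomogeneous (homogeneousSubmodule _ k))
    {y : MvPolynomial (Fin (n + 1)) k} (hy : y ∈ idealOfVars (Fin (n + 1)) k)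
    (hreg : IsSMulRegular (MvPolynomial (Fin (n + 1)) k ⧸ I) y) :
    IsSMulRegular (MvPolynomial (Fin (n + 1)) k ⧸ I)
      (X (Fin.last n) : MvPolynomial (Fin (n + 1)) k) := by
  obtain ⟨N, hN⟩ := hqs.exists_forall_mem_of_X_last_mul_mem hI
  refine (isSMulRegular_quotient_iff_mem_of_smul_mem _ _).2 fun f hf => ?_
  refine mem_of_isSMulRegular_quotient_of_smul_mem (hreg.pow (N + 1)) ?_
  have hyf : y ^ (N + 1) * f ∈ idealOfVars (Fin (n + 1)) k ^ (N + 1) :=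
    Ideal.mul_mem_right _ _ (Ideal.pow_mem_pow hy _)
  rw [mem_pow_idealOfVars_iff] at hyf
  rw [smul_eq_mul, ← sum_homogeneousComponent (y ^ (N + 1) * f)]
  refine I.sum_mem fun d _ => ?_
  rcases le_or_gt d N with hd | hd
  · rw [homogeneousComponent_eq_zero' _ _ fun c hc => by have := hyf c hc; omega]
    exact I.zero_mem
  · refine hN d hd _ (homogeneousComponent_isHomogeneous _ _) ?_
    rw [← homogeneousComponent_X_mul, mul_left_comm]
    exact homogeneousComponent_mem_of_mem hI (I.mul_mem_left _ hf) _

end LastVariable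

section DropLast

variable {R : Type*} [CommSemiring R] {n : ℕ}

/-- The exponent vector `a` with an exponent `0` for one further, last variable appended. -/
noncomputable def snocZero (a : Fin n →₀ ℕ) : Fin (n + 1) →₀ ℕ := a.mapDomain Fin.castSucc

@[simp]
lemma snocZero_castSucc (a : Fin n →₀ ℕ) (i : Fin n) : snocZero a i.castSucc = a i :=
  Finsupp.mapDomain_apply (Fin.castSucc_injective n) a i

@[simp]
lemma snocZero_last (a : Fin n →₀ ℕ) : snocZero a (Fin.last n) = 0 :=
  Finsupp.mapDomain_of_notMem_range a _ (by simp)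

@[simp]
lemma degree_snocZero (a : Fin n →₀ ℕ) : (snocZero a).degree = a.degree :=
  Finsupp.degree_mapDomain _ a

lemma snocZero_comapDomain {a : Fin (n + 1) →₀ ℕ} (ha : a (Fin.last n) = 0) :
    snocZero (a.comapDomain Fin.castSucc (Fin.castSucc_injective n).injOn) = a := by
  ext i
  induction i using Fin.lastCases <;> simp [ha]

lemma snocZero_le_snocZero_iff {a b : Fin n →₀ ℕ} : snocZero a ≤ snocZero b ↔ a ≤ b := by
  simp [Finsupp.le_def, Fin.forall_fin_succ']

lemma degRevLex_snocZero_le_iff {a b : Fin n →₀ ℕ} :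
    (degRevLex (n + 1)).toSyn (snocZero a) ≤ (degRevLex (n + 1)).toSyn (snocZero b) ↔
      (degRevLex n).toSyn a ≤ (degRevLex n).toSyn b := by
  rw [← not_lt, ← not_lt, not_iff_not, degRevLex_lt_iff, degRevLex_lt_iff]
  simp [Fin.forall_fin_succ', Fin.exists_fin_succ']

variable (R n) in
/-- The specialization `x_n ↦ 0` of the last variable. -/
noncomputable def dropLast : MvPolynomial (Fin (n + 1)) R →ₐ[R] MvPolynomial (Fin n) R :=
  killCompl (Fin.castSucc_injective n)

@[simp]
lemma coeff_dropLast (f : MvPolynomial (Fin (n + 1)) R) (a : Fin n →₀ ℕ) :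
    coeff a (dropLast R n f) = coeff (snocZero a) f :=
  coeff_killCompl _

lemma mem_support_dropLast {f : MvPolynomial (Fin (n + 1)) R} {a : Fin n →₀ ℕ} :
    a ∈ (dropLast R n f).support ↔ snocZero a ∈ f.support := by
  simp

lemma dropLast_surjective : Function.Surjective (dropLast R n) := fun p =>
  ⟨rename Fin.castSucc p, killCompl_rename_app _ p⟩

lemma dropLast_homogeneousComponent (f : MvPolynomial (Fin (n + 1)) R) (d : ℕ) :
    dropLast R n (homogeneousComponent d f) = homogeneousComponent d (dropLast R n f) := by
  ext a
  simp [coeff_homogeneousComponent]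

lemma isHomogeneous_dropLast {f : MvPolynomial (Fin (n + 1)) R} {d : ℕ}
    (hf : f.IsHomogeneous d) : (dropLast R n f).IsHomogeneous d := by
  rw [← homogeneousComponent_eq_self hf, dropLast_homogeneousComponent]
  exact homogeneousComponent_isHomogeneous _ _

lemma dropLast_mem_idealOfVars {f : MvPolynomial (Fin (n + 1)) R}
    (hf : f ∈ idealOfVars (Fin (n + 1)) R) : dropLast R n f ∈ idealOfVars (Fin n) R := by
  rw [mem_idealOfVars_iff, constantCoeff_eq] at hf ⊢
  rwa [coeff_dropLast, snocZero, Finsupp.mapDomain_zero]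

lemma X_last_dvd_iff {f : MvPolynomial (Fin (n + 1)) R} :
    X (Fin.last n) ∣ f ↔ dropLast R n f = 0 := by
  have h := mem_ideal_span_X_image (x := f) (s := {Fin.last n})
  rw [Set.image_singleton, Ideal.mem_span_singleton] at h
  rw [h, eq_zero_iff]
  simp only [Set.mem_singleton_iff, exists_eq_left, coeff_dropLast]
  refine ⟨fun h a => ?_, fun h a ha ha0 => ?_⟩
  · by_contra ha
    exact h _ (mem_support_iff.2 ha) (snocZero_last a)
  · rw [← snocZero_comapDomain ha0, mem_support_iff] at ha
    exact ha (h _)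

lemma snocZero_degree_dropLast {f : MvPolynomial (Fin (n + 1)) R}
    (hf : (degRevLex (n + 1)).degree f (Fin.last n) = 0) :
    snocZero ((degRevLex n).degree (dropLast R n f)) = (degRevLex (n + 1)).degree f := by
  rcases eq_or_ne f 0 with rfl | hf0
  · simp [snocZero]
  rw [← snocZero_comapDomain hf]
  congr 1
  refine degree_eq_of_mem_support ?_ fun c hc => ?_
  · rw [mem_support_dropLast, snocZero_comapDomain hf]
    exact (degRevLex (n + 1)).degree_mem_support hf0
  · rw [← degRevLex_snocZero_le_iff, snocZero_comapDomain hf]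
    exact (degRevLex (n + 1)).le_degree (mem_support_dropLast.1 hc)

lemma leadingCoeff_dropLast {f : MvPolynomial (Fin (n + 1)) R}
    (hf : (degRevLex (n + 1)).degree f (Fin.last n) = 0) :
    (degRevLex n).leadingCoeff (dropLast R n f) = (degRevLex (n + 1)).leadingCoeff f := by
  rw [MonomialOrder.leadingCoeff, coeff_dropLast, snocZero_degree_dropLast hf,
    MonomialOrder.leadingCoeff]

lemma dropLast_ne_zero {f : MvPolynomial (Fin (n + 1)) R} (hf0 : f ≠ 0)
    (hf : (degRevLex (n + 1)).degree f (Fin.last n) = 0) : dropLast R n f ≠ 0 := by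
  rwa [← (degRevLex n).leadingCoeff_ne_zero_iff, leadingCoeff_dropLast hf,
    MonomialOrder.leadingCoeff_ne_zero_iff]

lemma totalDegree_dropLast {f : MvPolynomial (Fin (n + 1)) R}
    (hf : (degRevLex (n + 1)).degree f (Fin.last n) = 0) :
    (dropLast R n f).totalDegree = f.totalDegree := by
  rw [totalDegree_eq_degree_degRevLex, totalDegree_eq_degree_degRevLex,
    ← snocZero_degree_dropLast hf, degree_snocZero]

/-- The degree reverse lexicographic order makes the terms divisible by the last variable smaller
than all other terms of the same degree. -/
lemma degree_last_eq_zero_of_dropLast_ne_zero {f : MvPolynomial (Fin (n + 1)) R} {d : ℕ}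
    (hf : f.IsHomogeneous d) (h : dropLast R n f ≠ 0) :
    (degRevLex (n + 1)).degree f (Fin.last n) = 0 := by
  obtain ⟨a, ha⟩ := support_nonempty.2 h
  rw [mem_support_dropLast] at ha
  have hf0 : f ≠ 0 := by
    rintro rfl
    simp at ha
  rcases ((degRevLex (n + 1)).le_degree ha).eq_or_lt with he | hlt
  · rw [← (degRevLex (n + 1)).toSyn.injective he, snocZero_last]
  rcases degRevLex_lt_iff.1 hlt with hlt | ⟨-, i, hi, hlt⟩
  · rw [degree_eq_of_isHomogeneous hf ha, degree_eq_of_isHomogeneous hf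
      ((degRevLex (n + 1)).degree_mem_support hf0)] at hlt
    exact absurd hlt (lt_irrefl d)
  · rcases (Fin.le_last i).eq_or_lt with rfl | hlast
    · simp at hlt
    · rw [← hi _ hlast, snocZero_last]

end DropLast

section Specialization

attribute [local instance] MvPolynomial.gradedAlgebra

variable {R : Type*} {n : ℕ}

lemma mem_map_dropLast [CommSemiring R] {I : Ideal (MvPolynomial (Fin (n + 1)) R)}
    {g : MvPolynomial (Fin n) R} : g ∈ I.map (dropLast R n) ↔ ∃ f ∈ I, dropLast R n f = g :=
  Ideal.mem_map_iff_of_surjective _ dropLast_surjective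

lemma isHomogeneous_map_dropLast [CommSemiring R] {I : Ideal (MvPolynomial (Fin (n + 1)) R)}
    (hI : I.IsHomogeneous (homogeneousSubmodule _ R)) :
    (I.map (dropLast R n)).IsHomogeneous (homogeneousSubmodule _ R) := by
  intro i g hg
  obtain ⟨f, hf, rfl⟩ := mem_map_dropLast.1 hg
  rw [DirectSum.decompose, Equiv.coe_fn_mk, decomposition.decompose'_apply]
  exact mem_map_dropLast.2 ⟨_, homogeneousComponent_mem_of_mem hI hf i,
    dropLast_homogeneousComponent f i⟩

lemma mem_leadExps_map_dropLast [CommSemiring R] {I : Ideal (MvPolynomial (Fin (n + 1)) R)}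
    (hI : I.IsHomogeneous (homogeneousSubmodule _ R)) {a : Fin n →₀ ℕ} :
    a ∈ leadExps (degRevLex n) (I.map (dropLast R n)) ↔
      snocZero a ∈ leadExps (degRevLex (n + 1)) I := by
  constructor
  · intro ha
    obtain ⟨g, hg, hg0, rfl, hgd⟩ :=
      exists_isHomogeneous_of_mem_leadExps (isHomogeneous_map_dropLast hI) ha
    obtain ⟨f, hf, rfl⟩ := mem_map_dropLast.1 hg
    set e := ((degRevLex n).degree (dropLast R n f)).degree
    have hfg : dropLast R n (homogeneousComponent e f) = dropLast R n f := by
      rw [dropLast_homogeneousComponent, homogeneousComponent_eq_self hgd]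
    rw [← hfg] at hg0 ⊢
    refine ⟨_, homogeneousComponent_mem_of_mem hI hf e, fun h => hg0 (by rw [h, map_zero]), ?_⟩
    exact (snocZero_degree_dropLast <| degree_last_eq_zero_of_dropLast_ne_zero
      (homogeneousComponent_isHomogeneous e f) hg0).symm
  · rintro ⟨f, hf, hf0, ha⟩
    have hlast : (degRevLex (n + 1)).degree f (Fin.last n) = 0 := by rw [ha, snocZero_last]
    refine ⟨_, Ideal.mem_map_of_mem _ hf, dropLast_ne_zero hf0 hlast, ?_⟩
    refine le_antisymm ?_ ?_ <;>
      rw [← snocZero_le_snocZero_iff, snocZero_degree_dropLast hlast, ha]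

lemma erase_last_mem_leadExps [CommRing R] {I : Ideal (MvPolynomial (Fin (n + 1)) R)}
    (hI : I.IsHomogeneous (homogeneousSubmodule _ R))
    (hreg : IsSMulRegular (MvPolynomial (Fin (n + 1)) R ⧸ I)
      (X (Fin.last n) : MvPolynomial (Fin (n + 1)) R))
    {a : Fin (n + 1) →₀ ℕ} (ha : a ∈ leadExps (degRevLex (n + 1)) I) :
    a.erase (Fin.last n) ∈ leadExps (degRevLex (n + 1)) I := by
  set m := degRevLex (n + 1)
  induction hs : a (Fin.last n) generalizing a with
  | zero => rwa [Finsupp.erase_of_notMem_support (by simpa using hs)]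
  | succ s ih =>
    obtain ⟨f, hf, hf0, rfl, hfd⟩ := exists_isHomogeneous_of_mem_leadExps hI ha
    obtain ⟨g, rfl⟩ : X (Fin.last n) ∣ f := by
      rw [X_last_dvd_iff]
      by_contra h
      exact s.succ_ne_zero (hs.symm.trans (degree_last_eq_zero_of_dropLast_ne_zero hfd h))
    have hg0 : g ≠ 0 := right_ne_zero_of_mul hf0
    have : Nontrivial R := nontrivial_of_ne _ _ (m.leadingCoeff_ne_zero_iff.2 hg0)
    have hdeg : m.degree (X (Fin.last n) * g) = Finsupp.single (Fin.last n) 1 + m.degree g := by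
      rw [m.degree_mul_of_isRegular_left (by simp [isRegular_one]) hg0, m.degree_X]
    rw [hdeg] at hs ⊢
    rw [Finsupp.erase_add, Finsupp.erase_single, zero_add]
    have hg : g ∈ I := mem_of_isSMulRegular_quotient_of_smul_mem hreg hf
    exact ih ⟨g, hg, hg0, rfl⟩ (by simpa [add_comm 1] using hs)

lemma map_dropLast_ne_bot [CommRing R] {I : Ideal (MvPolynomial (Fin (n + 1)) R)}
    (hI : I.IsHomogeneous (homogeneousSubmodule _ R))
    (hreg : IsSMulRegular (MvPolynomial (Fin (n + 1)) R ⧸ I)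
      (X (Fin.last n) : MvPolynomial (Fin (n + 1)) R)) (h0 : I ≠ ⊥) :
    I.map (dropLast R n) ≠ ⊥ := by
  obtain ⟨a, ha⟩ := leadExps_nonempty_iff (m := degRevLex (n + 1)).2 h0
  have herase := erase_last_mem_leadExps hI hreg ha
  rw [← snocZero_comapDomain Finsupp.erase_same, ← mem_leadExps_map_dropLast hI] at herase
  exact leadExps_nonempty_iff.1 ⟨_, herase⟩

variable {k : Type*} [Field k]

lemma InQuasiStablePosition.map_dropLast {I : Ideal (MvPolynomial (Fin (n + 1)) k)}
    (hqs : InQuasiStablePosition I) (hI : I.IsHomogeneous (homogeneousSubmodule _ k)) :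
    InQuasiStablePosition (I.map (dropLast k n)) := by
  rw [inQuasiStablePosition_iff] at hqs ⊢
  simp only [mem_leadExps_map_dropLast hI]
  intro a ha i j hij s hs hsa
  obtain ⟨t, ht⟩ := hqs _ ha i.castSucc j.castSucc (by simpa using hij) s hs (by simpa using hsa)
  refine ⟨t, ?_⟩
  convert ht using 1
  ext l
  induction l using Fin.lastCases with
  | last => simp
  | cast l => simp [Finsupp.single_apply]

lemma IsGeneratedInDegreeLE.map_dropLast {I : Ideal (MvPolynomial (Fin (n + 1)) k)} {d : ℕ}
    (h : IsGeneratedInDegreeLE I d) : IsGeneratedInDegreeLE (I.map (dropLast k n)) d := by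
  classical
  obtain ⟨F, hF, rfl⟩ := h
  refine ⟨(F.image (dropLast k n)).erase 0, fun g hg => ?_, ?_⟩
  · obtain ⟨hg0, hg⟩ := Finset.mem_erase.1 hg
    obtain ⟨f, hf, rfl⟩ := Finset.mem_image.1 hg
    obtain ⟨-, e, he0, hed, he⟩ := hF f hf
    exact ⟨hg0, e, he0, hed, isHomogeneous_dropLast he⟩
  · rw [Ideal.map_span, Finset.coe_erase, Finset.coe_image, Ideal.span_sdiff_singleton_zero]

variable {I : Ideal (MvPolynomial (Fin (n + 1)) k)}
  {G : Finset (MvPolynomial (Fin (n + 1)) k)}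

lemma IsReducedGroebnerBasis.degree_last_eq_zero
    (hG : IsReducedGroebnerBasis (degRevLex (n + 1)) I G)
    (hI : I.IsHomogeneous (homogeneousSubmodule _ k))
    (hreg : IsSMulRegular (MvPolynomial (Fin (n + 1)) k ⧸ I)
      (X (Fin.last n) : MvPolynomial (Fin (n + 1)) k))
    {g : MvPolynomial (Fin (n + 1)) k} (hg : g ∈ G) :
    (degRevLex (n + 1)).degree g (Fin.last n) = 0 := by
  set m := degRevLex (n + 1)
  obtain ⟨g', hg', hle⟩ := hG.exists_degree_le
    (erase_last_mem_leadExps hI hreg ⟨g, hG.subset g hg, hG.ne_zero hg, rfl⟩)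
  have heq : g' = g := by
    by_contra hne
    refine hG.reduced g hg g' hg' hne _ (m.degree_mem_support (hG.ne_zero hg))
      (hle.trans fun i => ?_)
    rw [Finsupp.erase_apply]
    split_ifs
    exacts [Nat.zero_le _, le_rfl]
  simpa [heq] using hle (Fin.last n)

lemma IsReducedGroebnerBasis.image_dropLast [DecidableEq (MvPolynomial (Fin n) k)]
    (hG : IsReducedGroebnerBasis (degRevLex (n + 1)) I G)
    (hI : I.IsHomogeneous (homogeneousSubmodule _ k))
    (hreg : IsSMulRegular (MvPolynomial (Fin (n + 1)) k ⧸ I)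
      (X (Fin.last n) : MvPolynomial (Fin (n + 1)) k)) :
    IsReducedGroebnerBasis (degRevLex n) (I.map (dropLast k n)) (G.image (dropLast k n)) := by
  have hlast {g} (hg : g ∈ G) := hG.degree_last_eq_zero hI hreg hg
  have hmem : ∀ g ∈ G, dropLast k n g ∈ I.map (dropLast k n) := fun g hg =>
    Ideal.mem_map_of_mem _ (hG.subset g hg)
  refine ⟨?_, (leadingIdeal_eq_span_degree_iff ?_).2 fun a ha => ?_, ?_, ?_⟩ <;>
    simp only [Finset.forall_mem_image, Finset.exists_mem_image]
  · exact hmem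
  · exact fun g hg => ⟨hmem g hg, dropLast_ne_zero (hG.ne_zero hg) (hlast hg)⟩
  · obtain ⟨g, hg, hga⟩ := hG.exists_degree_le ((mem_leadExps_map_dropLast hI).1 ha)
    exact ⟨g, hg, by rwa [← snocZero_le_snocZero_iff, snocZero_degree_dropLast (hlast hg)]⟩
  · exact fun g hg => (leadingCoeff_dropLast (hlast hg)).trans (hG.monic g hg)
  · intro g hg g' hg' hne a ha hle
    refine hG.reduced g hg g' hg' (fun h => hne (by rw [h])) _ (mem_support_dropLast.1 ha) ?_
    rwa [← snocZero_degree_dropLast (hlast hg'), snocZero_le_snocZero_iff]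

lemma IsGroebnerDegree.map_dropLast {e : ℕ} (he : IsGroebnerDegree (degRevLex (n + 1)) I e)
    (hI : I.IsHomogeneous (homogeneousSubmodule _ k))
    (hreg : IsSMulRegular (MvPolynomial (Fin (n + 1)) k ⧸ I)
      (X (Fin.last n) : MvPolynomial (Fin (n + 1)) k)) :
    IsGroebnerDegree (degRevLex n) (I.map (dropLast k n)) e := by
  classical
  obtain ⟨G, hG, hmax⟩ := he
  refine ⟨_, hG.image_dropLast hI hreg, ?_⟩
  convert hmax using 1
  ext s
  simp only [Finset.exists_mem_image, Set.mem_ofPred_eq]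
  exact exists_congr fun g => and_congr_right fun hg => by
    rw [totalDegree_dropLast (hG.degree_last_eq_zero hI hreg hg)]

end Specialization

section Dimension

lemma ringKrullDim_eq_of_isIntegral {R S : Type*} [CommRing R] [CommRing S] {f : R →+* S}
    (hf : f.IsIntegral) (hinj : Function.Injective f) : ringKrullDim S = ringKrullDim R := by
  let : Algebra R S := f.toAlgebra
  have : Algebra.IsIntegral R S := ⟨hf⟩
  apply le_antisymm
  · exact Order.krullDim_le_of_strictMono (PrimeSpectrum.comap (algebraMap R S))
      fun p q h => Ideal.IsIntegral.comap_lt_comap (R := R) (I := p.asIdeal) (J := q.asIdeal) h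
  · refine iSup_le fun l => ?_
    have hker : RingHom.ker (algebraMap R S) ≤ l.head.asIdeal :=
      ((RingHom.injective_iff_ker_eq_bot _).1 hinj).trans_le bot_le
    obtain ⟨Q, -, hQ, hQl⟩ :=
      Ideal.exists_ideal_over_prime_of_isIntegral (S := S) l.head.asIdeal ⊥ hker
    have : Q.LiesOver l.head.asIdeal := ⟨hQl.symm⟩
    obtain ⟨L, hL, -⟩ := Ideal.exists_ltSeries_of_hasGoingUp l Q
    rw [← hL]
    exact le_iSup (fun p : LTSeries (PrimeSpectrum S) => (p.length : WithBot ℕ∞)) L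

variable {σ : Type*} {n : ℕ}

/-- The canonical map from the polynomial ring in the variables with index in `T` to the quotient
of the full polynomial ring by `I`. -/
noncomputable def varsToQuotient {R : Type*} [CommRing R] (T : Set σ)
    (I : Ideal (MvPolynomial σ R)) : MvPolynomial T R →+* MvPolynomial σ R ⧸ I :=
  (Ideal.Quotient.mk I).comp (rename ((↑) : T → σ)).toRingHom

lemma varsToQuotient_apply {R : Type*} [CommRing R] (T : Set σ) (I : Ideal (MvPolynomial σ R))
    (p : MvPolynomial T R) : varsToQuotient T I p = Ideal.Quotient.mk I (rename (↑) p) :=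
  rfl

lemma varsToQuotient_injective {R : Type*} [CommRing R] {m : MonomialOrder σ} {T : Set σ}
    {I : Ideal (MvPolynomial σ R)} (h : ∀ a ∈ leadExps m I, ∃ i ∈ a.support, i ∉ T) :
    Function.Injective (varsToQuotient T I) := by
  classical
  rw [injective_iff_map_eq_zero]
  intro p hp
  rw [varsToQuotient_apply, Ideal.Quotient.eq_zero_iff_mem] at hp
  by_contra hp0
  have hr0 : rename ((↑) : T → σ) p ≠ 0 :=
    (rename_eq_zero_iff_of_injective p Subtype.val_injective).not.2 hp0
  obtain ⟨i, hi, hiT⟩ := h _ ⟨_, hp, hr0, rfl⟩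
  have hs := m.degree_mem_support hr0
  rw [support_rename_of_injective Subtype.val_injective] at hs
  obtain ⟨b, -, hb⟩ := Finset.mem_image.1 hs
  rw [← hb] at hi
  obtain ⟨j, -, rfl⟩ := Finset.mem_image.1 (Finsupp.mapDomain_support hi)
  exact hiT j.2

lemma exists_rename_mul_monomial_filter {R : Type*} [CommSemiring R] (T : Set σ)
    [DecidablePred (· ∈ T)] (a : σ →₀ ℕ) (c : R) :
    ∃ p : MvPolynomial T R,
      rename (↑) p * monomial (a.filter (· ∉ T)) 1 = monomial a c := by
  refine ⟨monomial ((a.filter (· ∈ T)).comapDomain (↑) Subtype.val_injective.injOn) c, ?_⟩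
  rw [rename_monomial, Finsupp.mapDomain_comapDomain _ Subtype.val_injective, monomial_mul,
    mul_one, Finsupp.filter_add_filter_not a (· ∈ T)]
  simp +contextual [Set.subset_def]

/-- The indices of the variables of which no power is a leading term. -/
def freeIndices {R : Type*} [CommSemiring R] (m : MonomialOrder σ)
    (I : Ideal (MvPolynomial σ R)) : Set σ :=
  {i | ∀ s : ℕ, Finsupp.single i s ∉ leadExps m I}

variable {k : Type*} [Field k]

/-- Modulo `I` every polynomial is a combination of standard monomials, and in these the exponents
of the non-free variables are bounded. -/
lemma varsToQuotient_freeIndices_finite [Finite σ] (m : MonomialOrder σ)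
    (I : Ideal (MvPolynomial σ k)) : (varsToQuotient (freeIndices m I) I).Finite := by
  classical
  cases nonempty_fintype σ
  set T := freeIndices m I
  let : Algebra (MvPolynomial T k) (MvPolynomial σ k ⧸ I) := (varsToQuotient T I).toAlgebra
  let : Module (MvPolynomial T k) (MvPolynomial σ k ⧸ I) := Algebra.toModule
  have hpow : ∀ i ∉ T, ∃ s : ℕ, Finsupp.single i s ∈ leadExps m I := fun i hi => by
    simpa [T, freeIndices] using hi
  choose! s hs using hpow
  set B : Set (MvPolynomial σ k ⧸ I) :=
    (fun b => Ideal.Quotient.mk I (monomial b 1)) '' Set.Iic (Finsupp.equivFunOnFinite.symm s)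
  have hB : B.Finite := (Set.finite_Iic _).image _
  refine Module.finite_def.2 (Submodule.fg_def.2 ⟨B, hB, eq_top_iff.2 fun x _ => ?_⟩)
  obtain ⟨f, rfl⟩ := Ideal.Quotient.mk_surjective x
  obtain ⟨g, hg, r, rfl, hr⟩ := exists_mem_add_eq_of_notMem_leadExps m I f
  rw [map_add, Ideal.Quotient.eq_zero_iff_mem.2 hg, zero_add, ← r.support_sum_monomial_coeff,
    map_sum]
  refine Submodule.sum_mem _ fun c hc => ?_
  obtain ⟨p, hp⟩ := exists_rename_mul_monomial_filter T c (coeff c r)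
  rw [← hp, map_mul, ← varsToQuotient_apply]
  refine Submodule.smul_mem _ p (Submodule.subset_span ⟨_, fun i => ?_, rfl⟩)
  rw [Finsupp.filter_apply]
  split_ifs with hi
  · exact Nat.zero_le _
  · by_contra! hlt
    exact hr c hc (isUpperSet_leadExps I (Finsupp.single_le_iff.2 hlt.le) (hs i hi))

lemma ringKrullDim_quotient_eq_ncard_freeIndices [Finite σ] {m : MonomialOrder σ}
    {I : Ideal (MvPolynomial σ k)}
    (h : ∀ a ∈ leadExps m I, ∃ i ∈ a.support, i ∉ freeIndices m I) :
    ringKrullDim (MvPolynomial σ k ⧸ I) = (freeIndices m I).ncard := by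
  rw [ringKrullDim_eq_of_isIntegral (varsToQuotient_freeIndices_finite m I).to_isIntegral
    (varsToQuotient_injective h), MvPolynomial.ringKrullDim_of_isNoetherianRing,
    ringKrullDim_eq_zero_of_field, zero_add, Nat.card_coe_set_eq]

lemma InQuasiStablePosition.exists_single_mem_leadExps {I : Ideal (MvPolynomial (Fin n) k)}
    (hqs : InQuasiStablePosition I) {i : Fin n} {S : Finset (Fin n)} (hS : ∀ j ∈ S, i < j)
    {a : Fin n →₀ ℕ} (ha : a ∈ leadExps (degRevLex n) I) (hsupp : a.support ⊆ insert i S) :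
    ∃ s : ℕ, Finsupp.single i s ∈ leadExps (degRevLex n) I := by
  induction S using Finset.induction generalizing a with
  | empty =>
    obtain ⟨s, rfl⟩ := Finsupp.support_subset_singleton'.1 hsupp
    exact ⟨s, ha⟩
  | insert j S _ ih =>
    have hij : i < j := hS j (Finset.mem_insert_self j S)
    have hS' : ∀ l ∈ S, i < l := fun l hl => hS l (Finset.mem_insert_of_mem hl)
    by_cases haj : a j = 0
    · refine ih hS' ha fun l hl => ?_
      have := hsupp hl
      grind
    obtain ⟨t, ht⟩ := inQuasiStablePosition_iff.1 hqs a ha j i hij (a j)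
      (Nat.pos_of_ne_zero haj) le_rfl
    refine ih hS' ht fun l hl => ?_
    have hsl := @hsupp l
    simp only [Finsupp.mem_support_iff, Finsupp.add_apply, Finsupp.tsub_apply,
      Finsupp.single_apply, Finset.mem_insert] at hl hsl ⊢
    grind

lemma InQuasiStablePosition.exists_notMem_freeIndices {I : Ideal (MvPolynomial (Fin n) k)}
    (hqs : InQuasiStablePosition I) (hI : I ≠ ⊤) {a : Fin n →₀ ℕ}
    (ha : a ∈ leadExps (degRevLex n) I) : ∃ i ∈ a.support, i ∉ freeIndices (degRevLex n) I := by
  have ha0 : a ≠ 0 := fun h0 => zero_notMem_leadExps hI (h0 ▸ ha)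
  set i := a.support.min' (Finsupp.support_nonempty_iff.2 ha0)
  have hi : i ∈ a.support := a.support.min'_mem _
  obtain ⟨s, hs⟩ := hqs.exists_single_mem_leadExps (S := a.support.erase i)
    (fun j hj => a.support.min'_lt_of_mem_erase_min' _ hj) ha (Finset.insert_erase hi).ge
  exact ⟨i, hi, fun hfree => hfree s hs⟩

lemma InQuasiStablePosition.ringKrullDim_quotient {I : Ideal (MvPolynomial (Fin n) k)}
    (hqs : InQuasiStablePosition I) (hI : I ≠ ⊤) :
    ringKrullDim (MvPolynomial (Fin n) k ⧸ I) = (freeIndices (degRevLex n) I).ncard :=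
  ringKrullDim_quotient_eq_ncard_freeIndices fun _ => hqs.exists_notMem_freeIndices hI

attribute [local instance] MvPolynomial.gradedAlgebra

lemma freeIndices_eq_insert {I : Ideal (MvPolynomial (Fin (n + 1)) k)} (htop : I ≠ ⊤)
    (hI : I.IsHomogeneous (homogeneousSubmodule _ k))
    (hreg : IsSMulRegular (MvPolynomial (Fin (n + 1)) k ⧸ I)
      (X (Fin.last n) : MvPolynomial (Fin (n + 1)) k)) :
    freeIndices (degRevLex (n + 1)) I =
      insert (Fin.last n) (Fin.castSucc '' freeIndices (degRevLex n) (I.map (dropLast k n))) := by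
  ext i
  induction i using Fin.lastCases with
  | last =>
    simp only [Set.mem_insert_iff, true_or, iff_true]
    intro s hs
    have herase := erase_last_mem_leadExps hI hreg hs
    rw [Finsupp.erase_single] at herase
    exact zero_notMem_leadExps htop herase
  | cast i =>
    rw [Set.mem_insert_iff, or_iff_right (Fin.castSucc_lt_last i).ne,
      (Fin.castSucc_injective n).mem_set_image]
    refine forall_congr' fun s => ?_
    rw [mem_leadExps_map_dropLast hI, snocZero, Finsupp.mapDomain_single]

lemma InQuasiStablePosition.ringKrullDim_map_dropLast
    {I : Ideal (MvPolynomial (Fin (n + 1)) k)} (hqs : InQuasiStablePosition I)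
    (htop : I ≠ ⊤) (htop' : I.map (dropLast k n) ≠ ⊤)
    (hI : I.IsHomogeneous (homogeneousSubmodule _ k))
    (hreg : IsSMulRegular (MvPolynomial (Fin (n + 1)) k ⧸ I)
      (X (Fin.last n) : MvPolynomial (Fin (n + 1)) k)) :
    ringKrullDim (MvPolynomial (Fin (n + 1)) k ⧸ I) =
      ringKrullDim (MvPolynomial (Fin n) k ⧸ I.map (dropLast k n)) + 1 := by
  rw [hqs.ringKrullDim_quotient htop, (hqs.map_dropLast hI).ringKrullDim_quotient htop',
    freeIndices_eq_insert htop hI hreg,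
    Set.ncard_insert_of_notMem (by simp [Fin.castSucc_ne_last]),
    Set.ncard_image_of_injective _ (Fin.castSucc_injective n)]
  norm_cast

end Dimension

section RegularSequence

open RingTheory.Sequence CategoryTheory Abelian Pointwise

universe u

/-- By Rees' theorem, sequences of length `l + 1` in `J` which are regular on `M` are detected by
the vanishing of `Ext (R ⧸ J) M i` for `i ≤ l`, which passes to `M / x M` in one degree less by the
long exact sequence. -/
lemma exists_isRegular_quotSMulTop {R : Type u} [CommRing R] [IsNoetherianRing R] {J : Ideal R}
    {M : Type u} [AddCommGroup M] [Module R M] [Module.Finite R M]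
    {x : R} (hxJ : x ∈ J) (hx : IsSMulRegular M x) (hJ : J • (⊤ : Submodule R M) ≠ ⊤)
    {ys : List R} {l : ℕ} (hl : ys.length = l + 1) (hys : ∀ y ∈ ys, y ∈ J) (hreg : IsRegular M ys) :
    ∃ zs : List R, zs.length = l ∧ (∀ z ∈ zs, z ∈ J) ∧ IsRegular (QuotSMulTop x M) zs := by
  have hJx : J • (⊤ : Submodule R (QuotSMulTop x M)) ≠ ⊤ := by
    intro htop
    absurd congrArg (Submodule.comap (Submodule.mkQ _)) htop
    simpa [Submodule.comap_smul_top_of_surjective J _ (Submodule.mkQ_surjective _),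
      Submodule.smul_mono_left ((Ideal.span_singleton_le_iff_mem J).mpr hxJ),
      ← Submodule.ideal_span_singleton_smul] using hJ
  have hext : ∀ i < l + 1, Subsingleton
      (Ext (ModuleCat.of R (Shrink.{u} (R ⧸ J))) (ModuleCat.of R M) i) := by
    have hrees := (ModuleCat.exists_isRegular_tfae J (l + 1) (ModuleCat.of R M) hJ.lt_top).out 3 1
    exact hrees.1 ⟨ys, hl, hys, hreg⟩
  refine ((ModuleCat.exists_isRegular_tfae J l
    (ModuleCat.of R (QuotSMulTop x M)) hJx.lt_top).out 1 3).1 fun i hi => ?_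
  have hzero := AddCommGrpCat.isZero_of_iff_subsingleton.mpr (hext i (by omega))
  have hzero' := AddCommGrpCat.isZero_of_iff_subsingleton.mpr (hext (i + 1) (by omega))
  exact AddCommGrpCat.subsingleton_of_isZero <| ShortComplex.Exact.isZero_of_both_zeros
    (Ext.covariant_sequence_exact₃' _
      (IsSMulRegular.smulShortComplex_shortExact (M := ModuleCat.of R M) hx) i (i + 1) rfl)
    (hzero.eq_zero_of_src _) (hzero'.eq_zero_of_tgt _)

lemma smul_top_quotient_ne_top {R : Type*} [CommRing R] {I J : Ideal R} (hIJ : I ≤ J)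
    (hJ : J ≠ ⊤) : J • (⊤ : Submodule R (R ⧸ I)) ≠ ⊤ := by
  rw [Ideal.smul_top_eq_map, Ne, Submodule.restrictScalars_eq_top_iff]
  intro htop
  rw [← Ideal.comap_map_mk hIJ, ← Ideal.Quotient.algebraMap_eq, htop, Ideal.comap_top] at hJ
  exact hJ rfl

/-- Both modules are quotients of `R` by `I ⊔ ker φ`. -/
lemma isRegular_quotient_map_of_surjective {R S : Type*} [CommRing R] [CommRing S] {φ : R →+* S}
    (hφ : Function.Surjective φ) {x : R} (hker : RingHom.ker φ = Ideal.span {x}) {I : Ideal R}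
    {zs : List R} (hreg : IsRegular (QuotSMulTop x (R ⧸ I)) zs) :
    IsRegular (S ⧸ I.map φ) (zs.map φ) := by
  let : Algebra R S := φ.toAlgebra
  let f : R →ₗ[R] QuotSMulTop x (R ⧸ I) := (Submodule.mkQ _).comp (Submodule.mkQ I)
  let g : R →ₗ[R] S ⧸ I.map φ := Algebra.linearMap R (S ⧸ I.map φ)
  have hf : Function.Surjective f :=
    (Submodule.mkQ_surjective _).comp (Submodule.mkQ_surjective I)
  have hg : Function.Surjective g := Ideal.Quotient.mk_surjective.comp hφ
  have hkerf : LinearMap.ker f = Ideal.span {x} ⊔ I := by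
    rw [LinearMap.ker_comp, Submodule.ker_mkQ, ← Submodule.ideal_span_singleton_smul,
      Submodule.comap_smul_top_of_surjective _ _ (Submodule.mkQ_surjective I), Submodule.ker_mkQ,
      smul_eq_mul, Ideal.mul_top]
  have hkerg : LinearMap.ker g = I ⊔ RingHom.ker φ := by
    rw [← Ideal.comap_map_of_surjective' φ hφ]
    ext r
    exact Ideal.Quotient.eq_zero_iff_mem
  let e : QuotSMulTop x (R ⧸ I) ≃ₗ[R] S ⧸ I.map φ :=
    (f.quotKerEquivOfSurjective hf).symm ≪≫ₗ
      Submodule.quotEquivOfEq _ _ (by rw [hkerf, hkerg, hker, sup_comm]) ≪≫ₗ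
      g.quotKerEquivOfSurjective hg
  refine (e.toAddEquiv.isRegular_congr ?_).1 hreg
  exact List.forall₂_map_right_iff.2 (List.forall₂_same.2 fun r _ m =>
    (e.map_smul r m).trans (algebraMap_smul S r (e m)).symm)

lemma ker_dropLast {R : Type*} [CommRing R] {n : ℕ} :
    RingHom.ker (dropLast R n) = Ideal.span {X (Fin.last n)} := by
  ext f
  rw [RingHom.mem_ker, Ideal.mem_span_singleton, X_last_dvd_iff]

end RegularSequence

section Reduction

open RingTheory.Sequence

variable {k : Type*} [Field k] {n d : ℕ}

lemma exists_isRegular_map_dropLast {I : Ideal (MvPolynomial (Fin (n + 1)) k)}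
    (hI : I ≤ idealOfVars (Fin (n + 1)) k)
    (hlast : IsSMulRegular (MvPolynomial (Fin (n + 1)) k ⧸ I)
      (X (Fin.last n) : MvPolynomial (Fin (n + 1)) k))
    {ys : List (MvPolynomial (Fin (n + 1)) k)} {l : ℕ} (hl : ys.length = l + 1)
    (hys : ∀ y ∈ ys, y ∈ idealOfVars (Fin (n + 1)) k)
    (hreg : IsRegular (MvPolynomial (Fin (n + 1)) k ⧸ I) ys) :
    ∃ zs : List (MvPolynomial (Fin n) k), zs.length = l ∧
      (∀ z ∈ zs, z ∈ idealOfVars (Fin n) k) ∧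
      IsRegular (MvPolynomial (Fin n) k ⧸ I.map (dropLast k n)) zs := by
  have hX : (X (Fin.last n) : MvPolynomial (Fin (n + 1)) k) ∈ idealOfVars (Fin (n + 1)) k :=
    Ideal.subset_span ⟨_, rfl⟩
  obtain ⟨zs, hzl, hzs, hzreg⟩ := exists_isRegular_quotSMulTop hX hlast
    (smul_top_quotient_ne_top hI idealOfVars_ne_top) hl hys hreg
  exact ⟨zs.map (dropLast k n), by rw [List.length_map, hzl],
    List.forall_mem_map.2 fun z hz => dropLast_mem_idealOfVars (hzs z hz),
    isRegular_quotient_map_of_surjective dropLast_surjective ker_dropLast hzreg⟩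

lemma IsGeneratedInDegreeLE.ne_top {I : Ideal (MvPolynomial (Fin n) k)}
    (hgen : IsGeneratedInDegreeLE I d) : I ≠ ⊤ :=
  ne_top_of_le_ne_top idealOfVars_ne_top hgen.le_idealOfVars

lemma InQuasiStablePosition.exists_specialization_of_isRegular
    {I : Ideal (MvPolynomial (Fin n) k)} (hqs : InQuasiStablePosition I) (hI : I ≠ ⊥)
    (hgen : IsGeneratedInDegreeLE I d) {ys : List (MvPolynomial (Fin n) k)}
    (hys : ∀ y ∈ ys, y ∈ idealOfVars (Fin n) k)
    (hreg : IsRegular (MvPolynomial (Fin n) k ⧸ I) ys) :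
    ∃ (n' : ℕ) (J : Ideal (MvPolynomial (Fin n') k)), n = n' + ys.length ∧ J ≠ ⊥ ∧
      IsGeneratedInDegreeLE J d ∧ InQuasiStablePosition J ∧
      ringKrullDim (MvPolynomial (Fin n) k ⧸ I) =
        ringKrullDim (MvPolynomial (Fin n') k ⧸ J) + ys.length ∧
      ∀ e, IsGroebnerDegree (degRevLex n) I e → IsGroebnerDegree (degRevLex n') J e := by
  induction hl : ys.length generalizing n I ys with
  | zero => exact ⟨n, I, rfl, hI, hgen, hqs, by simp, fun _ => id⟩
  | succ l ih =>
    obtain - | n := n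
    · refine absurd (le_bot_iff.1 (hgen.le_idealOfVars.trans ?_)) hI
      simp [idealOfVars]
    obtain ⟨y, ys', rfl⟩ := List.exists_cons_of_length_eq_add_one hl
    have hhom := hgen.isHomogeneous
    have hlast := hqs.isSMulRegular_X_last hhom (hys y List.mem_cons_self)
      ((isRegular_cons_iff _ _ _).1 hreg).1
    obtain ⟨zs, hzl, hzs, hzreg⟩ :=
      exists_isRegular_map_dropLast hgen.le_idealOfVars hlast hl hys hreg
    obtain ⟨n', J, rfl, hJ, hJgen, hJqs, hdim, hdeg⟩ := ih (hqs.map_dropLast hhom)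
      (map_dropLast_ne_bot hhom hlast hI) hgen.map_dropLast hzs hzreg hzl
    refine ⟨n', J, rfl, hJ, hJgen, hJqs, ?_, fun e he => hdeg e (he.map_dropLast hhom hlast)⟩
    rw [hqs.ringKrullDim_map_dropLast hgen.ne_top hgen.map_dropLast.ne_top hhom hlast, hdim,
      Nat.cast_succ, add_assoc]

lemma ringKrullDim_quotient_le_card {σ : Type*} [Finite σ] (I : Ideal (MvPolynomial σ k)) :
    ringKrullDim (MvPolynomial σ k ⧸ I) ≤ Nat.card σ := by
  simpa [MvPolynomial.ringKrullDim_of_isNoetherianRing] using ringKrullDim_quotient_le I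

end Reduction

theorem mainTheorem8_general {k : Type*} [Field k] (U : ℕ → ℕ → ℕ → ℝ)
    (hU : ∀ (n d D : ℕ) (I : Ideal (MvPolynomial (Fin n) k)), I ≠ ⊥ →
      IsGeneratedInDegreeLE I d → InQuasiStablePosition I →
      ringKrullDim (MvPolynomial (Fin n) k ⧸ I) = D →
      ∀ e : ℕ, IsGroebnerDegree (degRevLex n) I e → (e : ℝ) ≤ U n d D)
    (n d D : ℕ) (I : Ideal (MvPolynomial (Fin n) k)) (hI : I ≠ ⊥)
    (hgen : IsGeneratedInDegreeLE I d) (hqs : InQuasiStablePosition I)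
    (hdim : ringKrullDim (MvPolynomial (Fin n) k ⧸ I) = D)
    {ys : List (MvPolynomial (Fin n) k)} (hys : ∀ y ∈ ys, y ∈ idealOfVars (Fin n) k)
    (hreg : RingTheory.Sequence.IsRegular (MvPolynomial (Fin n) k ⧸ I) ys) :
    ys.length ≤ D ∧ D ≤ n ∧ ∀ e : ℕ, IsGroebnerDegree (degRevLex n) I e →
      (e : ℝ) ≤ U (n - ys.length) d (D - ys.length) := by
  have hDn : D ≤ n := by simpa [hdim] using ringKrullDim_quotient_le_card I
  obtain ⟨n', J, hn, hJ, hJgen, hJqs, hJdim, hdeg⟩ :=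
    hqs.exists_specialization_of_isRegular hI hgen hys hreg
  rw [hdim, hJqs.ringKrullDim_quotient hJgen.ne_top] at hJdim
  have hD : D = (freeIndices (degRevLex n') J).ncard + ys.length := by exact_mod_cast hJdim
  refine ⟨by omega, hDn, fun e he => ?_⟩
  rw [Nat.sub_eq_of_eq_add hn, Nat.sub_eq_of_eq_add hD]
  exact hU n' d _ J hJ hJgen hJqs (hJqs.ringKrullDim_quotient hJgen.ne_top) e (hdeg e he)

theorem mainTheorem8 {k : Type*} [Field k] [CharZero k] (U : ℕ → ℕ → ℕ → ℝ)
    (hU : ∀ (n d D : ℕ) (I : Ideal (MvPolynomial (Fin n) k)), I ≠ ⊥ →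
      IsGeneratedInDegreeLE I d → InQuasiStablePosition I →
      ringKrullDim (MvPolynomial (Fin n) k ⧸ I) = D →
      ∀ e : ℕ, IsGroebnerDegree (degRevLex n) I e → (e : ℝ) ≤ U n d D)
    (n d D l : ℕ) (I : Ideal (MvPolynomial (Fin n) k)) (hI : I ≠ ⊥)
    (hgen : IsGeneratedInDegreeLE I d) (hqs : InQuasiStablePosition I)
    (hdim : ringKrullDim (MvPolynomial (Fin n) k ⧸ I) = D) (hdepth : IsDepth I l) :
    l ≤ D ∧ D ≤ n ∧
      ∀ e : ℕ, IsGroebnerDegree (degRevLex n) I e → (e : ℝ) ≤ U (n - l) d (D - l) := by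
  obtain ⟨⟨ys, rfl, hlin, hreg⟩, -⟩ := hdepth
  exact mainTheorem8_general U hU n d D I hI hgen hqs hdim
    (fun y hy => mem_idealOfVars_of_isHomogeneous (hlin y hy) one_pos) hreg
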